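/- For integers $q,d\ge 2$ and $n\ge 0$ let $\mathbb{T}_{d,n}$ be the $d$-ary tree of height $n$ (every non-leaf vertex has $d$ children and every path from the root to a leaf has $n$ edges), with root $v_{d,n}$ and set of leaves $\Lambda_{d,n}$. For $\beta\in(0,1)$, the (antiferromagnetic) $q$-state Potts model with parameter $\beta$ on a finite graph $G=(V,E)$ is the probability distribution on configurations $\sigma:V\to[q]=\{1,\dots,q\}$ given by $\Pr_G[\sigma]=\beta^{m(\sigma)}/Z_G$, where $m(\sigma)$ is the number of edges of $G$ whose two endpoints have the same colour under $\sigma$ and $Z_G=\sum_{\sigma':V\to[q]}\beta^{m(\sigma')}$. The model has *uniqueness* on the infinite $d$-ary tree if for every colour $c\in[q]$ \[ \limsup_{n\to\infty}\ \max_{\tau:\Lambda_{d,n}\to[q]}\ \Bigl|\Pr\nolimits_{\mathbb{T}_{d,n}}\bigl[\sigma(v_{d,n})=c \,\big|\, \sigma|_{\Lambda_{d,n}}=\tau\bigr]-\tfrac1q\Bigr| = 0 . \] Then the $3$-state Potts model on the $3$-ary tree has uniqueness for all $\beta\in[1/4,1)$, and the $4$-state Potts model on the $4$-ary tree has uniqueness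 for all $\beta\in[1/5,1)$. -/

import Mathlib

noncomputable section

namespace Potts

section Graph

/-! ### The `q`-state Potts model on a finite graph -/

/-- The number `m(σ)` of monochromatic edges of `G` under the configuration `σ`. -/
def monoEdges {V : Type} {q : ℕ} (G : SimpleGraph V) (σ : V → Fin q) : ℕ :=
  Set.ncard {e ∈ G.edgeSet | (e.map σ).IsDiag}

/-- The weight `w_G(σ) = β ^ m(σ)`. -/
def weight {V : Type} {q : ℕ} (G : SimpleGraph V) (β : ℝ) (σ : V → Fin q) : ℝ :=
  β ^ monoEdges G σ

/-- The partition function `Z_G = ∑ σ, w_G(σ)`. -/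
def partitionFunction {V : Type} [Fintype V] [DecidableEq V] (G : SimpleGraph V) (q : ℕ)
    (β : ℝ) : ℝ :=
  ∑ σ : V → Fin q, weight G β σ

/-- The probability of the event `A` under the Gibbs distribution, which gives each
configuration `σ` the mass `w_G(σ) / Z_G`. -/
def gibbsProb {V : Type} [Fintype V] [DecidableEq V] {q : ℕ} (G : SimpleGraph V) (β : ℝ)
    (A : Set (V → Fin q)) : ℝ :=
  ∑ σ : V → Fin q, A.indicator (fun σ => weight G β σ / partitionFunction G q β) σ

/-- The conditional Gibbs probability of `A` given `B`; every non-empty event has positive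
probability when `0 < β`. -/
def gibbsCondProb {V : Type} [Fintype V] [DecidableEq V] {q : ℕ} (G : SimpleGraph V) (β : ℝ)
    (A B : Set (V → Fin q)) : ℝ :=
  gibbsProb G β (A ∩ B) / gibbsProb G β B

end Graph

section Tree

/-! ### The `d`-ary tree of height `n` -/

/-- The vertices of the `d`-ary tree of height `n`: a vertex is the word of directions on the
path that leads to it from the root. -/
abbrev TreeVertex (d n : ℕ) : Type := {u : List (Fin d) // u.length ≤ n}

instance (d n : ℕ) : Fintype (TreeVertex d n) :=
  (List.finite_length_le (Fin d) n).fintype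

/-- The `d`-ary tree of height `n`: the children of `u` are the words `u ++ [i]`. -/
def tree (d n : ℕ) : SimpleGraph (TreeVertex d n) :=
  SimpleGraph.fromRel fun u v => ∃ i : Fin d, v.1 = u.1 ++ [i]

/-- The root of the tree. -/
def root (d n : ℕ) : TreeVertex d n := ⟨[], Nat.zero_le n⟩

/-- The leaves of the tree. -/
def leaves (d n : ℕ) : Set (TreeVertex d n) := {u | u.1.length = n}

end Tree

/-- The conditional probability that the root of the `d`-ary tree of height `n` has colour `c`
given that the configuration on the leaves is `τ`. -/
def rootProb {q d n : ℕ} (β : ℝ) (c : Fin q) (τ : leaves d n → Fin q) : ℝ :=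
  gibbsCondProb (tree d n) β {σ | σ (root d n) = c} {σ | ∀ v : leaves d n, σ v = τ v}

/-- Uniqueness of the `q`-state Potts model with parameter `β > 0` on the infinite `d`-ary tree.
The supremum is the maximum over a finite set. -/
def HasUniqueness (q d : ℕ) (β : ℝ) : Prop :=
  ∀ c : Fin q,
    Filter.limsup (fun n : ℕ => ⨆ τ : leaves d n → Fin q, |rootProb β c τ - 1 / (q : ℝ)|)
      Filter.atTop = 0

end Potts

end

noncomputable section

namespace Potts

open Finset Filter Topology

/-! Write `κ = 1 - β`. Splitting the tree at its root shows that the root weight of a colour `c` is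
the product over the children of `lin κ r c = ∑ r - κ * r c`, with `r` the child's weight vector
(`rootWeight_succ`). Uniqueness follows once the ratios between root weights of different colours
tend to 1, uniformly in the boundary condition.

The ratio bound is propagated over two levels. If all grandchildren have ratios at most `a ^ d` with
`a > 1`, each child's factor should have ratio strictly below `a`, so that the product of `d`
factors beats `a ^ d`. This is positivity of `gap`, which is linear in each grandchild vector
separately; hence it suffices to test vectors with entries in `{1, a ^ d}` (`gap_pos_of_vertices`).
At `κ₀ = d / (d + 1)`, with `q = d` colours, the finitely many remaining inequalities are polynomial
in `x = a - 1` and hold coefficientwise, which the kernel checks (`certificate_three`,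
`certificate_four`). Smaller `κ` reduces to `κ₀` by mixing each vector with a constant one
(`lin_mix`).

At `κ₀` the linearised recursion at the uniform vector has slope of modulus 1, so no uniform
contraction rate is available. Instead, strictness and continuity show that the infimum of the
eventually valid bounds cannot exceed 1 (`eventuallyBalanced`). -/

/-! ### The recursion for the weights on the tree -/

/-- The neighbour of `v` on the path to the root; the root is its own parent. -/
def parent {d n : ℕ} (v : TreeVertex d n) : TreeVertex d n :=
  ⟨v.1.dropLast, by have := v.2; simp; omega⟩

/-- The vertex of the tree of height `n + 1` that corresponds to `w` in the subtree of the
`i`-th child of the root. -/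
def below {d n : ℕ} (i : Fin d) (w : TreeVertex d n) : TreeVertex d (n + 1) :=
  ⟨i :: w.1, by simpa using w.2⟩

theorem tree_adj {d n : ℕ} (u v : TreeVertex d n) :
    (tree d n).Adj u v ↔
      (v.1 ≠ [] ∧ u = parent v) ∨ (u.1 ≠ [] ∧ v = parent u) := by
  have key : ∀ u v : TreeVertex d n,
      (∃ i : Fin d, v.1 = u.1 ++ [i]) ↔ (v.1 ≠ [] ∧ u = parent v) := by
    intro u v
    constructor
    · rintro ⟨i, h⟩
      refine ⟨by simp [h], Subtype.ext ?_⟩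
      simp [parent, h]
    · rintro ⟨h, rfl⟩
      exact ⟨v.1.getLast h, (List.dropLast_append_getLast h).symm⟩
  unfold tree
  rw [SimpleGraph.fromRel_adj, key, key]
  constructor
  · exact fun h => h.2
  · intro h
    refine ⟨?_, h⟩
    rintro rfl
    have h' : u.1 ≠ [] ∧ u = parent u := by tauto
    have := congrArg (fun w => w.1.length) h'.2
    have hl := List.length_pos_iff.2 h'.1
    simp [parent] at this
    omega

/-- Each edge is indexed by its lower endpoint; comparing word lengths makes this injective. -/
theorem monoEdges_tree {d n q : ℕ} (σ : TreeVertex d n → Fin q) :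
    monoEdges (tree d n) σ = #{v | v.1 ≠ [] ∧ σ v = σ (parent v)} := by
  classical
  have himg : {e ∈ (tree d n).edgeSet | (e.map σ).IsDiag} =
      (fun v => s(parent v, v)) '' {v | v.1 ≠ [] ∧ σ v = σ (parent v)} := by
    ext e
    induction e using Sym2.ind with
    | _ u v =>
      simp only [Set.mem_ofPred_eq, SimpleGraph.mem_edgeSet, tree_adj, Sym2.map_mk,
        Sym2.mk_isDiag_iff, Set.mem_image]
      constructor
      · rintro ⟨⟨hv, rfl⟩ | ⟨hu, rfl⟩, h⟩
        · exact ⟨v, ⟨hv, h.symm⟩, rfl⟩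
        · exact ⟨u, ⟨hu, h⟩, Sym2.eq_swap⟩
      · rintro ⟨w, ⟨hw, h⟩, he⟩
        rcases Sym2.eq_iff.1 he with ⟨rfl, rfl⟩ | ⟨rfl, rfl⟩
        · exact ⟨Or.inl ⟨hw, rfl⟩, h.symm⟩
        · exact ⟨Or.inr ⟨hw, rfl⟩, h⟩
  have hinj : Set.InjOn (fun v : TreeVertex d n => s(parent v, v))
      {v | v.1 ≠ [] ∧ σ v = σ (parent v)} := by
    intro v hv w hw h
    rcases Sym2.eq_iff.1 h with ⟨_, h⟩ | ⟨h₁, h₂⟩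
    · exact h
    · have e₁ := congrArg (fun w => w.1.length) h₁
      have e₂ := congrArg (fun w => w.1.length) h₂
      have l₁ := List.length_pos_iff.2 hv.1
      have l₂ := List.length_pos_iff.2 hw.1
      simp [parent] at e₁ e₂
      omega
  unfold monoEdges
  rw [himg, hinj.ncard_image, ← Set.ncard_coe_finset]
  simp

theorem weight_tree {d n q : ℕ} (β : ℝ) (σ : TreeVertex d n → Fin q) :
    weight (tree d n) β σ =
      ∏ v : TreeVertex d n, if v.1 ≠ [] ∧ σ v = σ (parent v) then β else 1 := by
  rw [weight, monoEdges_tree, Finset.prod_ite]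
  simp

/-- The vertices of the tree of height `n + 1` are the root and the vertices below its
children. -/
def treeEquiv (d n : ℕ) : Option (Fin d × TreeVertex d n) ≃ TreeVertex d (n + 1) where
  toFun
    | none => root d (n + 1)
    | some p => below p.1 p.2
  invFun
    | ⟨[], _⟩ => none
    | ⟨i :: w, h⟩ => some (i, ⟨w, by simpa using h⟩)
  left_inv := by rintro (_ | ⟨i, w⟩) <;> rfl
  right_inv := by rintro ⟨_ | ⟨i, w⟩, h⟩ <;> rfl

theorem weight_tree_succ {d n q : ℕ} (β : ℝ) (σ : TreeVertex d (n + 1) → Fin q) :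
    weight (tree d (n + 1)) β σ =
      ∏ i : Fin d, (if σ (below i (root d n)) = σ (root d (n + 1)) then β else 1) *
        weight (tree d n) β (fun w => σ (below i w)) := by
  classical
  simp_rw [weight_tree]
  have hdecomp : ∀ f : TreeVertex d (n + 1) → ℝ,
      ∏ v, f v = f (root d (n + 1)) * ∏ i, ∏ w, f (below i w) := by
    intro f
    rw [← (treeEquiv d n).prod_comp, Fintype.prod_option, Fintype.prod_prod_type]
    rfl
  rw [hdecomp, if_neg (by simp [root]), one_mul]
  refine Finset.prod_congr rfl fun i _ => ?_
  -- Only the root of a subtree has its parent outside the subtree; elsewhere `below i` commutes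
  -- with `parent`.
  have hsplit : ∀ w : TreeVertex d n,
      (if (below i w).1 ≠ [] ∧ σ (below i w) = σ (parent (below i w)) then β else 1) =
        (if w = root d n then
          (if σ (below i (root d n)) = σ (root d (n + 1)) then β else 1) else 1) *
        (if w.1 ≠ [] ∧ σ (below i w) = σ (below i (parent w)) then β else 1) := by
    rintro ⟨_ | ⟨j, w⟩, hw⟩
    · have : parent (below i (⟨[], hw⟩ : TreeVertex d n)) = root d (n + 1) := rfl
      rw [this]
      simp only [root, below, ne_eq, not_true_eq_false, false_and, if_false, mul_one, if_true,
        reduceCtorEq, not_false_eq_true, true_and]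
      exact if_congr Iff.rfl rfl rfl
    · have : parent (below i (⟨j :: w, hw⟩ : TreeVertex d n)) =
          below i (parent ⟨j :: w, hw⟩) := rfl
      rw [this]
      simp [root, below]
  simp_rw [hsplit]
  rw [Finset.prod_mul_distrib, Finset.prod_ite_eq' Finset.univ (root d n)]
  simp

/-- A configuration on the tree of height `n + 1` is a colour of the root together with
configurations on the subtrees of its children. -/
def configEquiv (d n q : ℕ) :
    (Fin q × (Fin d → TreeVertex d n → Fin q)) ≃ (TreeVertex d (n + 1) → Fin q) where
  toFun p
    | ⟨[], _⟩ => p.1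
    | ⟨i :: w, h⟩ => p.2 i ⟨w, by simpa using h⟩
  invFun σ := (σ (root d (n + 1)), fun i w => σ (below i w))
  left_inv := by rintro ⟨c, f⟩; rfl
  right_inv := by
    intro σ
    funext v
    obtain ⟨_ | ⟨i, w⟩, h⟩ := v <;> rfl

/-- The configuration `σ` agrees on the leaves with the boundary condition `τ`. -/
def Agrees {d n q : ℕ} (τ : List (Fin d) → Fin q) (σ : TreeVertex d n → Fin q) : Prop :=
  ∀ v : TreeVertex d n, v.1.length = n → σ v = τ v.1

open Classical in
/-- The total weight of the configurations on the tree of height `n` that give the root the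
colour `c` and the leaves the colours `τ`. -/
def rootWeight {d q : ℕ} (β : ℝ) (n : ℕ) (τ : List (Fin d) → Fin q) (c : Fin q) : ℝ :=
  ∑ σ : TreeVertex d n → Fin q,
    if σ (root d n) = c ∧ Agrees τ σ then weight (tree d n) β σ else 0

theorem rootWeight_zero {d q : ℕ} (β : ℝ) (τ : List (Fin d) → Fin q) (c : Fin q) :
    rootWeight β 0 τ c = if c = τ [] then 1 else 0 := by
  classical
  have huniq : ∀ v : TreeVertex d 0, v = root d 0 := fun v =>
    Subtype.ext (List.length_eq_zero_iff.1 (Nat.le_zero.1 v.2))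
  have hw : ∀ σ : TreeVertex d 0 → Fin q, weight (tree d 0) β σ = 1 := by
    intro σ
    rw [weight_tree]
    refine Finset.prod_eq_one fun v _ => ?_
    rw [huniq v]
    simp [root]
  unfold rootWeight
  simp_rw [hw]
  have hiff : ∀ σ : TreeVertex d 0 → Fin q,
      (σ (root d 0) = c ∧ Agrees τ σ) ↔ (σ = (fun _ => c) ∧ c = τ []) := by
    intro σ
    constructor
    · rintro ⟨h, h'⟩
      refine ⟨funext fun v => by rw [huniq v, h], ?_⟩
      rw [← h]
      exact h' (root d 0) rfl
    · rintro ⟨rfl, h⟩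
      refine ⟨rfl, fun v _ => ?_⟩
      rw [huniq v]
      exact h
  simp_rw [hiff, ite_and]
  simp

/-- Given the root colour, the subtrees are independent, so the sum over configurations factors. The
edge to a child costs `β` exactly when the child has colour `c`, which removes `1 - β` times that
term from the full sum. -/
theorem rootWeight_succ {d q : ℕ} (β : ℝ) (n : ℕ) (τ : List (Fin d) → Fin q) (c : Fin q) :
    rootWeight β (n + 1) τ c =
      ∏ i : Fin d, ((∑ c', rootWeight β n (fun w => τ (i :: w)) c') -
        (1 - β) * rootWeight β n (fun w => τ (i :: w)) c) := by
  classical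
  have hagree : ∀ p : Fin q × (Fin d → TreeVertex d n → Fin q),
      Agrees τ (configEquiv d n q p) ↔ ∀ i, Agrees (fun w => τ (i :: w)) (p.2 i) := by
    rintro ⟨c', f⟩
    constructor
    · intro h i w hw
      exact h (below i w) (by simp [below, hw])
    · rintro h ⟨_ | ⟨i, w⟩, hv⟩ hl
      · simp at hl
      · exact h i ⟨w, by simpa using hv⟩ (by simpa using hl)
  have hterm : ∀ i : Fin d, (∑ g : TreeVertex d n → Fin q,
      if Agrees (fun w => τ (i :: w)) g then
        (if g (root d n) = c then β else 1) * weight (tree d n) β g else 0) =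
      ((∑ c', rootWeight β n (fun w => τ (i :: w)) c') -
        (1 - β) * rootWeight β n (fun w => τ (i :: w)) c) := by
    intro i
    unfold rootWeight
    rw [Finset.sum_comm, Finset.mul_sum, ← Finset.sum_sub_distrib]
    refine Finset.sum_congr rfl fun g _ => ?_
    simp_rw [ite_and]
    rw [Finset.sum_ite_eq Finset.univ (g (root d n))]
    by_cases h : Agrees (fun w => τ (i :: w)) g <;> by_cases h' : g (root d n) = c <;>
      simp [h, h']
    ring
  simp_rw [← hterm]
  rw [Finset.prod_univ_sum, Fintype.piFinset_univ]
  unfold rootWeight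
  rw [← (configEquiv d n q).sum_comp, Fintype.sum_prod_type, Finset.sum_eq_single c]
  · refine Finset.sum_congr rfl fun f _ => ?_
    rw [hagree, weight_tree_succ]
    have h1 : configEquiv d n q (c, f) (root d (n + 1)) = c := rfl
    have h2 : ∀ i w, configEquiv d n q (c, f) (below i w) = f i w := fun _ _ => rfl
    simp only [h1, h2, true_and]
    by_cases h : ∀ i, Agrees (fun w => τ (i :: w)) (f i)
    · rw [if_pos h]
      exact Finset.prod_congr rfl fun i _ => by rw [if_pos (h i)]
    · rw [if_neg h]
      push Not at h
      obtain ⟨i, hi⟩ := h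
      exact (Finset.prod_eq_zero (Finset.mem_univ i) (if_neg hi)).symm
  · intro c' _ hc
    refine Finset.sum_eq_zero fun f _ => if_neg ?_
    rintro ⟨h, _⟩
    exact hc h
  · simp

/-- Extending the boundary condition to all words lets it pass to subtrees by prepending a letter;
the partition function cancels. -/
theorem rootProb_eq {q d n : ℕ} {β : ℝ} (hβ : 0 < β) (c : Fin q) (τ : leaves d n → Fin q)
    (τ' : List (Fin d) → Fin q) (hτ : ∀ v : leaves d n, τ v = τ' v.1.1) :
    rootProb β c τ = rootWeight β n τ' c / ∑ c', rootWeight β n τ' c' := by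
  classical
  have hZ : partitionFunction (tree d n) q β ≠ 0 :=
    (Finset.sum_pos (fun σ _ => pow_pos hβ _) ⟨fun _ => c, Finset.mem_univ _⟩).ne'
  have hB : ∀ σ : TreeVertex d n → Fin q, (∀ v : leaves d n, σ v = τ v) ↔ Agrees τ' σ := by
    intro σ
    constructor
    · intro h v hv
      rw [h ⟨v, hv⟩, hτ]
    · intro h v
      rw [hτ]
      exact h v.1 v.2
  unfold rootProb gibbsCondProb gibbsProb
  have h1 : ∑ σ : TreeVertex d n → Fin q,
      ({σ | σ (root d n) = c} ∩ {σ | ∀ v : leaves d n, σ v = τ v} :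
        Set (TreeVertex d n → Fin q)).indicator
        (fun σ => weight (tree d n) β σ / partitionFunction (tree d n) q β) σ =
      rootWeight β n τ' c / partitionFunction (tree d n) q β := by
    unfold rootWeight
    rw [Finset.sum_div]
    refine Finset.sum_congr rfl fun σ _ => ?_
    simp only [Set.indicator_apply, Set.mem_inter_iff, Set.mem_ofPred_eq, hB]
    split_ifs <;> simp
  have h2 : ∑ σ : TreeVertex d n → Fin q,
      ({σ | ∀ v : leaves d n, σ v = τ v} : Set (TreeVertex d n → Fin q)).indicator
        (fun σ => weight (tree d n) β σ / partitionFunction (tree d n) q β) σ =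
      (∑ c', rootWeight β n τ' c') / partitionFunction (tree d n) q β := by
    unfold rootWeight
    rw [Finset.sum_comm, Finset.sum_div]
    refine Finset.sum_congr rfl fun σ _ => ?_
    simp_rw [ite_and]
    rw [Finset.sum_ite_eq Finset.univ (σ (root d n))]
    simp only [Set.indicator_apply, Set.mem_ofPred_eq, hB]
    split_ifs <;> simp_all
  rw [h1, h2, div_div_div_cancel_right₀ hZ]

/-! ### Polynomials with natural coefficients as lists -/

/-- The value at `x` of the polynomial with the coefficients `p`, constant term first. -/
def polyVal (x : ℝ) : List ℕ → ℝ
  | [] => 0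
  | a :: p => a + x * polyVal x p

/-- The polynomial `c * p + q`. -/
def polyAxpy (c : ℕ) : List ℕ → List ℕ → List ℕ
  | [], q => q
  | a :: p, [] => (c * a) :: polyAxpy c p []
  | a :: p, b :: q => (c * a + b) :: polyAxpy c p q

/-- The product of two polynomials. -/
def polyMul : List ℕ → List ℕ → List ℕ
  | [], _ => []
  | a :: p, q => polyAxpy a q (0 :: polyMul p q)

/-- Coefficientwise comparison. -/
def polyLe : List ℕ → List ℕ → Bool
  | [], _ => true
  | _ :: _, [] => false
  | a :: p, b :: q => Nat.ble a b && polyLe p q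

/-- Coefficientwise comparison, with at least one strict inequality. -/
def polyLt : List ℕ → List ℕ → Bool
  | [], _ => false
  | _ :: _, [] => false
  | a :: p, b :: q => Nat.ble a b && (polyLt p q || (Nat.blt a b && polyLe p q))

theorem polyVal_axpy (x : ℝ) (c : ℕ) (p q : List ℕ) :
    polyVal x (polyAxpy c p q) = c * polyVal x p + polyVal x q := by
  induction p generalizing q with
  | nil => simp [polyAxpy, polyVal]
  | cons a p ih =>
    cases q with
    | nil =>
      simp only [polyAxpy, polyVal, ih]
      push_cast
      ring
    | cons b q =>
      simp only [polyAxpy, polyVal, ih]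
      push_cast
      ring

theorem polyVal_mul (x : ℝ) (p q : List ℕ) :
    polyVal x (polyMul p q) = polyVal x p * polyVal x q := by
  induction p with
  | nil => simp [polyMul, polyVal]
  | cons a p ih =>
    simp only [polyMul, polyVal, polyVal_axpy, ih]
    push_cast
    ring

theorem polyVal_nonneg {x : ℝ} (hx : 0 ≤ x) (p : List ℕ) : 0 ≤ polyVal x p := by
  induction p with
  | nil => simp [polyVal]
  | cons a p ih =>
    simp only [polyVal]
    positivity

theorem polyVal_le {x : ℝ} (hx : 0 ≤ x) {p q : List ℕ} (h : polyLe p q) :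
    polyVal x p ≤ polyVal x q := by
  induction p generalizing q with
  | nil => exact polyVal_nonneg hx q
  | cons a p ih =>
    cases q with
    | nil => simp [polyLe] at h
    | cons b q =>
      simp only [polyLe, Bool.and_eq_true, Nat.ble_eq] at h
      have h1 : (a : ℝ) ≤ b := by exact_mod_cast h.1
      have h2 := mul_le_mul_of_nonneg_left (ih h.2) hx
      simp only [polyVal]
      linarith

theorem polyVal_lt {x : ℝ} (hx : 0 < x) {p q : List ℕ} (h : polyLt p q) :
    polyVal x p < polyVal x q := by
  induction p generalizing q with
  | nil => simp [polyLt] at h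
  | cons a p ih =>
    cases q with
    | nil => simp [polyLt] at h
    | cons b q =>
      simp only [polyLt, Bool.and_eq_true, Bool.or_eq_true, Nat.ble_eq, Nat.blt_eq] at h
      have h1 : (a : ℝ) ≤ b := by exact_mod_cast h.1
      simp only [polyVal]
      rcases h.2 with h2 | ⟨h2, h3⟩
      · have := mul_lt_mul_of_pos_left (ih h2) hx
        linarith
      · have h2 : (a : ℝ) < b := by exact_mod_cast h2
        have := mul_le_mul_of_nonneg_left (polyVal_le hx.le h3) hx.le
        linarith

/-! ### A search over multisets of vectors of polynomials -/

/-- The sum of a list of polynomials. -/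
def polySum : List (List ℕ) → List ℕ
  | [] => []
  | p :: l => polyAxpy 1 p (polySum l)

/-- The componentwise product of two vectors of polynomials. -/
def vecMul : List (List ℕ) → List (List ℕ) → List (List ℕ)
  | p :: l, q :: m => polyMul q p :: vecMul l m
  | _, _ => []

/-- Coefficientwise positivity of
`(b - 1 + b * x) * y₀ + (x - (b - 1)) * y₁ + b * x * (y₂ + y₃ + ⋯)`. -/
def vecPos (b : ℕ) : List (List ℕ) → Bool
  | y₀ :: y₁ :: l =>
    polyLt (polyAxpy (b - 1) y₁ [])
      (polyAxpy (b - 1) y₀ (0 :: polyAxpy b (polySum (y₀ :: l)) y₁))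
  | _ => false

/-- Positivity, in the sense of `vecPos`, of the products of `y` with all multisets of `d`
vectors from `T`. -/
def searchPos (b : ℕ) : ℕ → List (List (List ℕ)) → List (List ℕ) → Bool
  | 0, _, y => vecPos b y
  | d + 1, T, y => T.tails.all fun T' =>
      match T' with
      | [] => true
      | f :: _ => searchPos b d T' (vecMul y f)

/-- The list of polynomials `l` has the values `v` at `x`. -/
def Represents (x : ℝ) {q : ℕ} (l : List (List ℕ)) (v : Fin q → ℝ) : Prop :=
  l.map (polyVal x) = List.ofFn v

theorem polyVal_sum (x : ℝ) (l : List (List ℕ)) :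
    polyVal x (polySum l) = (l.map (polyVal x)).sum := by
  induction l with
  | nil => simp [polySum, polyVal]
  | cons p l ih => simp [polySum, polyVal_axpy, ih]

theorem Represents.mul {x : ℝ} {q : ℕ} {l m : List (List ℕ)} {v w : Fin q → ℝ}
    (hl : Represents x l v) (hm : Represents x m w) :
    Represents x (vecMul l m) (fun i => v i * w i) := by
  unfold Represents at *
  induction q generalizing l m with
  | zero =>
    have : l = [] := by simpa using hl
    subst this
    simp [vecMul]
  | succ q ih =>
    cases l with
    | nil => simp at hl
    | cons p l =>
      cases m with
      | nil => simp at hm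
      | cons p' m =>
        simp only [List.map_cons, List.ofFn_succ, List.cons.injEq] at hl hm
        simp only [vecMul, List.map_cons, List.ofFn_succ, List.cons.injEq, polyVal_mul, hl.1,
          hm.1, mul_comm (w 0), true_and]
        exact ih hl.2 hm.2

theorem pos_of_vecPos {x : ℝ} (hx : 0 < x) {b q : ℕ} (hb : 1 ≤ b) {l : List (List ℕ)}
    {v : Fin (q + 2) → ℝ} (hl : Represents x l v) (h : vecPos b l) :
    0 < (b - 1 + b * x) * v 0 + (x - (b - 1)) * v 1 + b * x * ∑ i : Fin q, v i.succ.succ := by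
  match l, h with
  | y₀ :: y₁ :: l, h =>
    simp only [Represents, List.map_cons, List.ofFn_succ, List.cons.injEq] at hl
    obtain ⟨h0, h1, h2⟩ := hl
    have h3 := congrArg List.sum h2
    rw [List.sum_ofFn, ← polyVal_sum] at h3
    have h4 := polyVal_lt hx h
    simp only [polyVal_axpy, polySum, polyVal, h0, h1, h3, Nat.cast_sub hb] at h4
    push_cast at h4
    have h5 : (Fin.succ 0 : Fin (q + 2)) = 1 := rfl
    rw [h5] at h4
    linarith

/-- The products do not depend on the order of `l`, so it may be sorted along `T`: either the head
of `T` represents a member of `l`, which is multiplied into `y` while the head stays available, or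
the head is discarded. -/
theorem pos_of_searchPos {x : ℝ} (hx : 0 < x) {b q : ℕ} (hb : 1 ≤ b) (d : ℕ)
    (T : List (List (List ℕ))) (y : List (List ℕ)) (v : Fin (q + 2) → ℝ)
    (hv : Represents x y v) (h : searchPos b d T y) (l : List (Fin (q + 2) → ℝ))
    (hl : l.length = d) (hT : ∀ w ∈ l, ∃ f ∈ T, Represents x f w) :
    0 < (b - 1 + b * x) * (v 0 * (l.map (· 0)).prod) +
      (x - (b - 1)) * (v 1 * (l.map (· 1)).prod) +
      b * x * ∑ i : Fin q, v i.succ.succ * (l.map (· i.succ.succ)).prod := by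
  classical
  induction d generalizing T y v l with
  | zero =>
    obtain rfl := List.length_eq_zero_iff.1 hl
    simpa using pos_of_vecPos hx hb hv h
  | succ d ih =>
    induction T with
    | nil =>
      obtain ⟨w, hw⟩ := List.exists_mem_of_length_pos (l := l) (by omega)
      obtain ⟨f, hf, _⟩ := hT w hw
      simp at hf
    | cons f T ihT =>
      simp only [searchPos, List.tails_cons, List.all_cons, Bool.and_eq_true] at h
      by_cases hf : ∃ w ∈ l, Represents x f w
      · obtain ⟨w, hw, hfw⟩ := hf
        have hp : ∀ i, (l.map (· i)).prod = w i * ((l.erase w).map (· i)).prod := by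
          intro i
          rw [((List.perm_cons_erase hw).map (· i)).prod_eq, List.map_cons, List.prod_cons]
        have := ih (f :: T) (vecMul y f) (fun i => v i * w i) (hv.mul hfw) h.1 (l.erase w)
          (by rw [List.length_erase_of_mem hw]; omega)
          (fun u hu => hT u (List.mem_of_mem_erase hu))
        simp only [hp, ← mul_assoc] at this ⊢
        exact this
      · push Not at hf
        refine ihT ?_ ?_
        · simpa only [searchPos] using h.2
        · intro w hw
          obtain ⟨g, hg, hgw⟩ := hT w hw
          rcases List.mem_cons.1 hg with rfl | hg
          · exact absurd hgw (hf w hw)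
          · exact ⟨g, hg, hgw⟩

/-- The lists of truth values of length `q`. -/
def boolLists : ℕ → List (List Bool)
  | 0 => [[]]
  | q + 1 => (boolLists q).map (List.cons true) ++ (boolLists q).map (List.cons false)

theorem mem_boolLists {q : ℕ} {l : List Bool} (h : l.length = q) : l ∈ boolLists q := by
  induction q generalizing l with
  | zero => simp_all [boolLists]
  | succ q ih =>
    cases l with
    | nil => simp at h
    | cons a l =>
      have := ih (l := l) (by simpa using h)
      cases a <;> simp [boolLists, this]

/-- The vector with the components `b * ∑ r - (b - 1) * r i`, where `r i = α` if `S i` and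
`r i = 1` otherwise. -/
def factors (b : ℕ) (α : List ℕ) (S : List Bool) : List (List ℕ) :=
  S.map fun s => match s with
    | true => polyAxpy (1 + b * (S.count true - 1)) α [b * S.count false]
    | false => polyAxpy (b * S.count true) α [1 + b * (S.count false - 1)]

theorem sum_map_cond (A : ℝ) (S : List Bool) :
    (S.map fun s => if s then A else 1).sum = S.count true * A + S.count false := by
  induction S with
  | nil => simp
  | cons s S ih =>
    rw [List.map_cons, List.sum_cons, ih]
    cases s <;> simp <;> ring

theorem represents_factors {x A : ℝ} {b q : ℕ} {α : List ℕ} (hα : polyVal x α = A)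
    (S : Fin q → Bool) :
    Represents x (factors b α (List.ofFn S))
      (fun i => b * (∑ k, if S k then A else 1) - (b - 1) * (if S i then A else 1)) := by
  have hsum : (∑ k, if S k then A else 1) =
      (List.ofFn S).count true * A + (List.ofFn S).count false := by
    rw [← sum_map_cond, List.map_ofFn, List.sum_ofFn]
    rfl
  unfold Represents factors
  rw [hsum, List.map_map, List.map_ofFn]
  congr 1
  funext i
  have hmem : S i ∈ List.ofFn S := List.mem_ofFn.2 ⟨i, rfl⟩
  -- Index `i` itself is counted, so the truncated subtraction in `factors` is exact.
  have hc := List.count_pos_iff.2 hmem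
  simp only [Function.comp_apply]
  cases hS : S i <;> rw [hS] at hc <;>
    simp only [polyVal_axpy, polyVal, hα] <;> push_cast [Nat.cast_sub hc] <;>
    simp <;> ring

/-- The certificate for vertices: it is decided by comparing natural numbers. -/
def certificate (b q d : ℕ) (α : List ℕ) : Bool :=
  searchPos b d (((boolLists q).filter fun S => !S.getD 1 true).map (factors b α))
    (List.replicate q [1])

/-- The coefficient list is `(1 + x) ^ 3 = a ^ 3`, and `b = d + 1` encodes `κ₀ = 3 / 4`. -/
theorem certificate_three : certificate 4 3 3 [1, 3, 3, 1] = true := by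
  decide +kernel

theorem certificate_four : certificate 5 4 4 [1, 4, 6, 4, 1] = true := by
  decide +kernel

/-! ### The tree recursion on vectors of root weights -/

/-- The factor that a child with the vector `r` of root weights contributes to the weight of the
colour `c` of its parent, for `κ = 1 - β`. -/
def lin {q : ℕ} (κ : ℝ) (r : Fin q → ℝ) (c : Fin q) : ℝ := (∑ i, r i) - κ * r c

/-- All entries of `r` are positive, and their ratios are at most `α`. -/
def Balanced {q : ℕ} (α : ℝ) (r : Fin q → ℝ) : Prop :=
  (∀ c, 0 < r c) ∧ ∀ c c', r c ≤ α * r c'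

/-- The vector with the entries `α` on `S` and `1` elsewhere. -/
def vertex {q : ℕ} (α : ℝ) (S : Fin q → Bool) (c : Fin q) : ℝ := if S c then α else 1

/-- The difference `a * lin κ Y 1 - lin κ Y 0`. -/
def gap {q : ℕ} (κ a : ℝ) (Y : Fin (q + 2) → ℝ) : ℝ :=
  (a - 1) * ∑ i, Y i + κ * (Y 0 - a * Y 1)

/-- The coefficients of the linear form `gap κ a`. -/
def gapCoeff {q : ℕ} (κ a : ℝ) : Fin (q + 2) → ℝ :=
  Fin.cons (a - 1 + κ) (Fin.cons (a - 1 - κ * a) fun _ => a - 1)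

theorem gap_eq_sum {q : ℕ} (κ a : ℝ) (Y : Fin (q + 2) → ℝ) :
    gap κ a Y = ∑ i, gapCoeff κ a i * Y i := by
  have h1 : (Fin.succ 0 : Fin (q + 2)) = 1 := rfl
  simp only [gap, gapCoeff, Fin.sum_univ_succ, Fin.cons_zero, Fin.cons_succ, h1,
    ← Finset.mul_sum]
  ring

theorem gap_smul {q : ℕ} (κ a t : ℝ) (Y : Fin (q + 2) → ℝ) :
    gap κ a (fun c => t * Y c) = t * gap κ a Y := by
  simp only [gap, ← Finset.mul_sum]
  ring

/-- Exhibits `gap` as a linear form in one vector `r`, the other factors being collected in `Y`; the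
signs of its coefficients decide which vertex is extremal. -/
theorem gap_lin_mul {q : ℕ} (κ a : ℝ) (r Y : Fin (q + 2) → ℝ) :
    gap κ a (fun c => lin κ r c * Y c) =
      ∑ i, (gap κ a Y - κ * (gapCoeff κ a i * Y i)) * r i := by
  have h1 : ∑ i, (gap κ a Y - κ * (gapCoeff κ a i * Y i)) * r i =
      gap κ a Y * ∑ i, r i - κ * ∑ i, gapCoeff κ a i * Y i * r i := by
    rw [Finset.mul_sum, Finset.mul_sum, ← Finset.sum_sub_distrib]
    exact Finset.sum_congr rfl fun i _ => by ring
  rw [h1, gap_eq_sum, gap_eq_sum, Finset.sum_mul, Finset.mul_sum, ← Finset.sum_sub_distrib]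
  refine Finset.sum_congr rfl fun i _ => ?_
  simp only [lin]
  ring

/-- The coefficient of `r 1` in `gap_lin_mul` is nonnegative, so only vertices with the small value
at colour 1 matter. If `gapCoeff κ a 1` is positive, all coefficients of `gap` are nonnegative and a
single term is at most the whole sum. -/
theorem gapCoeff_one_mul_le {q : ℕ} {κ a : ℝ} (hκ : 0 ≤ κ) (hκ1 : κ ≤ 1) (ha : 1 ≤ a)
    {Y : Fin (q + 2) → ℝ} (hY : ∀ i, 0 ≤ Y i) (hG : 0 ≤ gap κ a Y) :
    κ * (gapCoeff (q := q) κ a 1 * Y 1) ≤ gap κ a Y := by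
  have h1 : gapCoeff (q := q) κ a 1 = a - 1 - κ * a := rfl
  by_cases h : a - 1 - κ * a ≤ 0
  · refine le_trans ?_ hG
    rw [h1]
    exact mul_nonpos_of_nonneg_of_nonpos hκ (mul_nonpos_of_nonpos_of_nonneg h (hY 1))
  · have h2 : gapCoeff (q := q) κ a 1 * Y 1 ≤ gap κ a Y := by
      rw [gap_eq_sum]
      refine Finset.single_le_sum (f := fun i => gapCoeff κ a i * Y i) (fun i _ => ?_)
        (Finset.mem_univ 1)
      refine mul_nonneg ?_ (hY i)
      refine Fin.cases ?_ (fun i => Fin.cases ?_ (fun i => ?_) i) i <;>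
        simp only [gapCoeff, Fin.cons_zero, Fin.cons_succ] <;> linarith
    have h3 : 0 ≤ gapCoeff (q := q) κ a 1 * Y 1 := by
      rw [h1]
      exact mul_nonneg (by linarith) (hY 1)
    exact (mul_le_of_le_one_left h3 hκ1).trans h2

theorem lin_pos {q : ℕ} {κ : ℝ} (hκ1 : κ < 1) {r : Fin q → ℝ} (hr : ∀ c, 0 < r c) (c : Fin q) :
    0 < lin κ r c := by
  have h1 : r c ≤ ∑ i, r i :=
    Finset.single_le_sum (fun i _ => (hr i).le) (Finset.mem_univ c)
  have h2 := mul_pos (sub_pos.2 hκ1) (hr c)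
  unfold lin
  linarith

theorem list_prod_lin_pos {q : ℕ} {κ : ℝ} (hκ1 : κ < 1) {l : List (Fin q → ℝ)}
    (hl : ∀ r ∈ l, ∀ c, 0 < r c) (c : Fin q) : 0 < (l.map (lin κ · c)).prod := by
  refine List.prod_pos ?_
  intro x hx
  obtain ⟨r, hr, rfl⟩ := List.mem_map.1 hx
  exact lin_pos hκ1 (hl r hr) c

theorem vertex_pos {q : ℕ} {α : ℝ} (hα : 0 < α) (S : Fin q → Bool) (c : Fin q) :
    0 < vertex α S c := by
  unfold vertex
  split_ifs <;> positivity

/-- Positivity of `gap` at products over balanced vectors follows from its positivity at products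
over vertices. -/
theorem gap_pos_of_vertices {q d : ℕ} {κ a α : ℝ} (hκ : 0 ≤ κ) (hκ1 : κ < 1) (ha : 1 ≤ a)
    (hα : 0 < α)
    (H : ∀ l : List (Fin (q + 2) → Bool), l.length ≤ d → (∀ S ∈ l, S 1 = false) →
      0 < gap κ a fun c => (l.map fun S => lin κ (vertex α S) c).prod)
    (l : List (Fin (q + 2) → ℝ)) (hl : ∀ r ∈ l, Balanced α r)
    (m : List (Fin (q + 2) → Bool)) (hm : ∀ S ∈ m, S 1 = false)
    (hd : l.length + m.length ≤ d) :
    0 < gap κ a fun c =>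
      (l.map (lin κ · c)).prod * (m.map fun S => lin κ (vertex α S) c).prod := by
  induction l generalizing m with
  | nil => simpa using H m (by simpa using hd) hm
  | cons r l ih =>
    simp only [List.length_cons] at hd
    have hr := hl r (by simp)
    have hl' : ∀ r ∈ l, Balanced α r := fun r h => hl r (by simp [h])
    set Y : Fin (q + 2) → ℝ := fun c =>
      (l.map (lin κ · c)).prod * (m.map fun S => lin κ (vertex α S) c).prod with hY
    have hG : 0 < gap κ a Y := ih hl' m hm (by omega)
    have hYpos : ∀ c, 0 ≤ Y c := by
      intro c
      refine mul_nonneg (list_prod_lin_pos hκ1 (fun r h => (hl' r h).1) c).le ?_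
      have := list_prod_lin_pos hκ1 (l := m.map (vertex α)) (by
        intro r hr
        obtain ⟨S, _, rfl⟩ := List.mem_map.1 hr
        exact vertex_pos hα S) c
      rw [List.map_map] at this
      exact this.le
    set D : Fin (q + 2) → ℝ := fun i => gap κ a Y - κ * (gapCoeff κ a i * Y i) with hD
    have hD1 : 0 ≤ D 1 := sub_nonneg.2 (gapCoeff_one_mul_le hκ hκ1.le ha hYpos hG.le)
    obtain ⟨i₀, -, hi₀⟩ := Finset.exists_min_image Finset.univ r ⟨0, Finset.mem_univ _⟩
    -- After scaling by the minimum `r i₀`, the linear form is smallest when entries with negative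
    -- coefficient are `α` and the others 1.
    let S : Fin (q + 2) → Bool := fun i => decide (D i < 0)
    have hS1 : S 1 = false := by simpa [S] using hD1
    have hv := ih hl' (S :: m) (by
      intro T hT
      rcases List.mem_cons.1 hT with rfl | hT
      · exact hS1
      · exact hm T hT) (by simp only [List.length_cons]; omega)
    have e1 : (fun c => ((r :: l).map (lin κ · c)).prod *
        (m.map fun S => lin κ (vertex α S) c).prod) = fun c => lin κ r c * Y c := by
      funext c
      simp only [hY, List.map_cons, List.prod_cons]
      ring
    have e2 : (fun c => (l.map (lin κ · c)).prod *
        ((S :: m).map fun S => lin κ (vertex α S) c).prod) =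
        fun c => lin κ (vertex α S) c * Y c := by
      funext c
      simp only [hY, List.map_cons, List.prod_cons]
      ring
    rw [e1, gap_lin_mul]
    rw [e2, gap_lin_mul] at hv
    refine lt_of_lt_of_le (mul_pos (hr.1 i₀) hv) ?_
    rw [Finset.mul_sum]
    refine Finset.sum_le_sum fun i _ => ?_
    change r i₀ * (D i * vertex α S i) ≤ D i * r i
    by_cases h : D i < 0
    · have : vertex α S i = α := by simp [vertex, S, h]
      rw [this]
      have := mul_le_mul_of_nonpos_left (hr.2 i i₀) h.le
      linarith
    · have : vertex α S i = 1 := by simp [vertex, S, h]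
      rw [this]
      have := mul_le_mul_of_nonneg_left (hi₀ i (Finset.mem_univ i)) (not_lt.1 h)
      linarith

/-- Positivity of `gap` at all products over `d` vertices for the ratio `a ^ d`; the entry of the
colour `1` may be assumed to be minimal. -/
def VertexPositive (q d : ℕ) (κ : ℝ) : Prop :=
  ∀ a : ℝ, 1 < a → ∀ S : Fin d → Fin (q + 2) → Bool, (∀ j, S j 1 = false) →
    0 < gap κ a fun c => ∏ j, lin κ (vertex (a ^ d) (S j)) c

/-- Adding a constant to `r` enlarges the sum relative to the subtracted entry, just as decreasing
`κ` does. For `κ ≤ κ₀` the constant is nonnegative, and `balanced_mix` keeps the ratio bound. -/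
theorem lin_mix {q : ℕ} {κ₀ κ : ℝ} (hκ : 0 < κ) (h0 : κ₀ ≠ 0) (hκ₀ : κ₀ < q)
    (r : Fin q → ℝ) (c : Fin q) :
    lin κ r c = κ / κ₀ * lin κ₀ (fun i => r i + (κ₀ / κ - 1) / (q - κ₀) * ∑ k, r k) c := by
  have : (q : ℝ) - κ₀ ≠ 0 := (sub_pos.2 hκ₀).ne'
  simp only [lin, Finset.sum_add_distrib, Finset.sum_const, Finset.card_univ, Fintype.card_fin,
    nsmul_eq_mul]
  field_simp
  ring

theorem balanced_mix {q : ℕ} {α t : ℝ} (hα : 1 ≤ α) (ht : 0 ≤ t) {r : Fin q → ℝ}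
    (hr : Balanced α r) : Balanced α fun i => r i + t * ∑ k, r k := by
  have hs : 0 ≤ t * ∑ k, r k := mul_nonneg ht (Finset.sum_nonneg fun k _ => (hr.1 k).le)
  refine ⟨fun c => add_pos_of_pos_of_nonneg (hr.1 c) hs, fun c c' => ?_⟩
  have h1 := hr.2 c c'
  have h2 := mul_le_mul_of_nonneg_right hα hs
  linarith

/-- Two levels of the recursion turn the ratio `(a + δ) ^ d` into the ratio `(a - δ) ^ d` for all
small `δ`. -/
theorem eventually_contracts {q d : ℕ} {κ₀ : ℝ} (hκ₀ : 0 < κ₀) (hκ₁ : κ₀ < 1)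
    (H : VertexPositive q d κ₀) {a : ℝ} (ha : 1 < a) :
    ∀ᶠ δ in 𝓝[>] (0 : ℝ), ∀ κ, 0 < κ → κ ≤ κ₀ → ∀ r : Fin d → Fin (q + 2) → ℝ,
      (∀ j, Balanced ((a + δ) ^ d) (r j)) → ∀ c c',
        lin κ (fun i => ∏ j, lin κ (r j) i) c ≤
          (a - δ) * lin κ (fun i => ∏ j, lin κ (r j) i) c' := by
  have hev : ∀ᶠ δ in 𝓝[>] (0 : ℝ), ∀ S : Fin d → Fin (q + 2) → Bool, (∀ j, S j 1 = false) →
      0 < gap κ₀ (a - δ) fun c => ∏ j, lin κ₀ (vertex ((a + δ) ^ d) (S j)) c := by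
    -- There are finitely many `S`, and each strict inequality persists near `δ = 0` by continuity.
    rw [Filter.eventually_all]
    intro S
    by_cases hS : ∀ j, S j 1 = false
    · have hcont : Continuous fun δ : ℝ =>
          gap κ₀ (a - δ) fun c => ∏ j, lin κ₀ (vertex ((a + δ) ^ d) (S j)) c := by
        have hvert : ∀ j c, Continuous fun δ : ℝ => vertex ((a + δ) ^ d) (S j) c := by
          intro j c
          unfold vertex
          split_ifs <;> fun_prop
        have hlin : ∀ j c, Continuous fun δ : ℝ => lin κ₀ (vertex ((a + δ) ^ d) (S j)) c := by
          intro j c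
          unfold lin
          have := hvert j
          fun_prop
        unfold gap
        fun_prop
      have h0 := (hcont.tendsto 0).eventually (lt_mem_nhds (a := 0) (by simpa using H a ha S hS))
      filter_upwards [nhdsWithin_le_nhds h0] with δ hδ _ using hδ
    · exact Filter.Eventually.of_forall fun δ h => absurd h hS
  have hsmall : ∀ᶠ δ in 𝓝[>] (0 : ℝ), δ < a - 1 :=
    nhdsWithin_le_nhds (gt_mem_nhds (by linarith))
  filter_upwards [hev, hsmall, self_mem_nhdsWithin] with δ hδ hδa hδ0
  intro κ hκ hκκ₀ r hr c c'
  have hδ0 : 0 < δ := hδ0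
  have hα : 1 ≤ (a + δ) ^ d := one_le_pow₀ (by linarith)
  have hb : 1 < a - δ := by linarith
  have hκq : κ₀ < ((q + 2 : ℕ) : ℝ) := by push_cast; linarith [Nat.cast_nonneg (α := ℝ) q]
  have hverts : ∀ l : List (Fin (q + 2) → Bool), l.length ≤ d → (∀ S ∈ l, S 1 = false) →
      0 < gap κ₀ (a - δ) fun c => (l.map fun S => lin κ₀ (vertex ((a + δ) ^ d) S) c).prod := by
    intro l hl hl1
    have key : ∀ l : List (Fin (q + 2) → Bool), l.length = d → (∀ S ∈ l, S 1 = false) →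
        0 < gap κ₀ (a - δ) fun c => (l.map fun S => lin κ₀ (vertex ((a + δ) ^ d) S) c).prod := by
      rintro l rfl hl
      have := hδ (fun j => l.get j) (fun j => hl _ (List.get_mem l j))
      have hprod : ∀ c, ∏ j, lin κ₀ (vertex ((a + δ) ^ l.length) (l.get j)) c =
          (l.map fun S => lin κ₀ (vertex ((a + δ) ^ l.length) S) c).prod := by
        intro c
        conv_rhs => rw [← List.ofFn_get l, List.map_ofFn, List.prod_ofFn]
        simp only [List.ofFn_get, Function.comp_apply]
      simpa only [hprod] using this
    -- Shorter products, needed by the induction over factors, are padded with the all-ones vertex,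
    -- which only scales by a positive constant.
    set p := List.replicate (d - l.length) (fun _ : Fin (q + 2) => false) with hp
    have h1 := key (p ++ l) (by simp [hp]; omega) (by
      intro S hS
      rcases List.mem_append.1 hS with h | h
      · rw [List.eq_of_mem_replicate h]
      · exact hl1 S h)
    have h2 : ∀ c, lin κ₀ (vertex ((a + δ) ^ d) fun _ : Fin (q + 2) => false) c =
        ((q + 2 : ℕ) : ℝ) - κ₀ := by
      intro c
      simp [lin, vertex]
    simp only [List.map_append, List.prod_append, hp, List.map_replicate, List.prod_replicate,
      h2] at h1
    rw [gap_smul] at h1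
    exact (pos_iff_pos_of_mul_pos h1).1 (pow_pos (sub_pos.2 hκq) _)
  have hgap : ∀ r : Fin d → Fin (q + 2) → ℝ, (∀ j, Balanced ((a + δ) ^ d) (r j)) →
      0 < gap κ₀ (a - δ) fun c => ∏ j, lin κ₀ (r j) c := by
    intro r hr
    have := gap_pos_of_vertices hκ₀.le hκ₁ hb.le (by linarith) hverts (List.ofFn r)
      (by
        intro s hs
        obtain ⟨j, rfl⟩ := List.mem_ofFn.1 hs
        exact hr j) [] (by simp) (by simp)
    simpa [List.map_ofFn, List.prod_ofFn] using this
  have hzero : ∀ r : Fin d → Fin (q + 2) → ℝ, (∀ j, Balanced ((a + δ) ^ d) (r j)) →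
      lin κ (fun i => ∏ j, lin κ (r j) i) 0 ≤
        (a - δ) * lin κ (fun i => ∏ j, lin κ (r j) i) 1 := by
    intro r hr
    set Y : Fin (q + 2) → ℝ := fun i => ∏ j, lin κ (r j) i with hY
    have hYpos : ∀ i, 0 < Y i := fun i =>
      Finset.prod_pos fun j _ => lin_pos (by linarith) (hr j).1 i
    have ht : 0 ≤ (κ₀ / κ - 1) / (((q + 2 : ℕ) : ℝ) - κ₀) :=
      div_nonneg (sub_nonneg.2 ((one_le_div hκ).2 hκκ₀)) (sub_pos.2 hκq).le
    have h1 := hgap _ fun j => balanced_mix hα ht (hr j)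
    have hYeq : Y = fun c => (κ / κ₀) ^ d * ∏ j, lin κ₀ (fun i => r j i +
        (κ₀ / κ - 1) / (((q + 2 : ℕ) : ℝ) - κ₀) * ∑ k, r j k) c := by
      funext c
      have h2 : ∀ j, lin κ (r j) c = κ / κ₀ * lin κ₀ (fun i => r j i +
          (κ₀ / κ - 1) / (((q + 2 : ℕ) : ℝ) - κ₀) * ∑ k, r j k) c := fun j =>
        lin_mix hκ hκ₀.ne' hκq (r j) c
      simp only [hY, h2, Finset.prod_mul_distrib, Finset.prod_const, Finset.card_univ,
        Fintype.card_fin]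
    have h3 : 0 < gap κ₀ (a - δ) Y := by
      rw [hYeq, gap_smul]
      exact mul_pos (pow_pos (div_pos hκ hκ₀) d) h1
    have h4 : 0 ≤ (a - δ - 1) * ∑ i, Y i :=
      mul_nonneg (by linarith) (Finset.sum_nonneg fun i _ => (hYpos i).le)
    -- The outer level also passes from `κ₀` to `κ`: `gap` is affine in `κ`, and its value at `κ =
    -- 0` is nonnegative.
    have h5 : gap κ (a - δ) Y =
        (1 - κ / κ₀) * ((a - δ - 1) * ∑ i, Y i) + κ / κ₀ * gap κ₀ (a - δ) Y := by
      unfold gap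
      field_simp
      ring
    have h6 : 0 ≤ gap κ (a - δ) Y := by
      rw [h5]
      exact add_nonneg (mul_nonneg (sub_nonneg.2 ((div_le_one hκ₀).2 hκκ₀)) h4)
        (mul_nonneg (div_pos hκ hκ₀).le h3.le)
    unfold gap at h6
    unfold lin
    linarith
  by_cases hcc : c = c'
  · subst hcc
    exact le_mul_of_one_le_left (lin_pos (by linarith) (fun i =>
      Finset.prod_pos fun j _ => lin_pos (by linarith) (hr j).1 i) c).le hb.le
  -- Colour symmetry reduces any pair of distinct colours to `0, 1`.
  · obtain ⟨e, he0, he1⟩ : ∃ e : Equiv.Perm (Fin (q + 2)), e 0 = c ∧ e 1 = c' := by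
      have h01 : (0 : Fin (q + 2)) ≠ 1 := by simp
      have hne : Equiv.swap 0 c 1 ≠ c := by
        intro h
        exact h01 ((Equiv.swap 0 c).injective (by rw [h, Equiv.swap_apply_left]))
      refine ⟨(Equiv.swap 0 c).trans (Equiv.swap (Equiv.swap 0 c 1) c'), ?_, ?_⟩
      · simp only [Equiv.trans_apply, Equiv.swap_apply_left]
        exact Equiv.swap_apply_of_ne_of_ne (Ne.symm hne) hcc
      · simp
    have hlin : ∀ (s : Fin (q + 2) → ℝ) i, lin κ (fun k => s (e k)) i = lin κ s (e i) := by
      intro s i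
      simp only [lin, Equiv.sum_comp e s]
    have h := hzero (fun j i => r j (e i)) fun j =>
      ⟨fun i => (hr j).1 _, fun i i' => (hr j).2 _ _⟩
    simp only [hlin] at h
    rw [hlin (fun i => ∏ j, lin κ (r j) i), hlin (fun i => ∏ j, lin κ (r j) i), he0, he1] at h
    exact h

/-! ### Uniqueness -/

theorem rootWeight_succ_eq_lin {d q : ℕ} (β : ℝ) (n : ℕ) (τ : List (Fin d) → Fin q) (c : Fin q) :
    rootWeight β (n + 1) τ c =
      ∏ i : Fin d, lin (1 - β) (rootWeight β n fun w => τ (i :: w)) c :=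
  rootWeight_succ β n τ c

theorem rootWeight_nonneg {d q : ℕ} {β : ℝ} (hβ : 0 < β) (n : ℕ) (τ : List (Fin d) → Fin q)
    (c : Fin q) : 0 ≤ rootWeight β n τ c := by
  classical
  refine Finset.sum_nonneg fun σ _ => ?_
  split_ifs
  · exact (pow_pos hβ _).le
  · exact le_rfl

theorem lin_le_of_nonneg {q : ℕ} {β : ℝ} (hβ1 : β ≤ 1) {r : Fin q → ℝ}
    (hr : ∀ c, 0 ≤ r c) (c : Fin q) :
    β * ∑ i, r i ≤ lin (1 - β) r c ∧ lin (1 - β) r c ≤ ∑ i, r i := by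
  have h1 : r c ≤ ∑ i, r i :=
    Finset.single_le_sum (fun i _ => hr i) (Finset.mem_univ c)
  have h2 := mul_le_mul_of_nonneg_left h1 (sub_nonneg.2 hβ1)
  have h3 := mul_nonneg (sub_nonneg.2 hβ1) (hr c)
  unfold lin
  constructor <;> linarith

/-- At height 0 the weight vector is an indicator, so positivity starts with the sum; individual
entries are positive only from height 1 on. -/
theorem sum_rootWeight_pos {d q : ℕ} {β : ℝ} (hβ : 0 < β) (hβ1 : β ≤ 1) (n : ℕ)
    (τ : List (Fin d) → Fin q) : 0 < ∑ c, rootWeight β n τ c := by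
  induction n generalizing τ with
  | zero => simp [rootWeight_zero]
  | succ n ih =>
    refine Finset.sum_pos (fun c _ => ?_) ⟨τ [], Finset.mem_univ _⟩
    rw [rootWeight_succ_eq_lin]
    exact Finset.prod_pos fun i _ => (mul_pos hβ (ih _)).trans_le
      (lin_le_of_nonneg hβ1 (rootWeight_nonneg hβ n _) c).1

theorem rootWeight_succ_pos {d q : ℕ} {β : ℝ} (hβ : 0 < β) (hβ1 : β ≤ 1) (n : ℕ)
    (τ : List (Fin d) → Fin q) (c : Fin q) : 0 < rootWeight β (n + 1) τ c := by
  rw [rootWeight_succ_eq_lin]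
  exact Finset.prod_pos fun i _ => (mul_pos hβ (sum_rootWeight_pos hβ hβ1 n _)).trans_le
    (lin_le_of_nonneg hβ1 (rootWeight_nonneg hβ n _) c).1

theorem balanced_rootWeight_succ {d q : ℕ} {β : ℝ} (hβ : 0 < β) (hβ1 : β ≤ 1) (n : ℕ)
    (τ : List (Fin d) → Fin q) : Balanced (β⁻¹ ^ d) (rootWeight β (n + 1) τ) := by
  refine ⟨rootWeight_succ_pos hβ hβ1 n τ, fun c c' => ?_⟩
  have hpow : β⁻¹ ^ d = ∏ _i : Fin d, β⁻¹ := by simp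
  rw [rootWeight_succ_eq_lin, rootWeight_succ_eq_lin, hpow, ← Finset.prod_mul_distrib]
  refine Finset.prod_le_prod (fun i _ => ?_) fun i _ => ?_
  · exact (mul_pos hβ (sum_rootWeight_pos hβ hβ1 n _)).le.trans
      (lin_le_of_nonneg hβ1 (rootWeight_nonneg hβ n _) c).1
  · have h1 := (lin_le_of_nonneg hβ1 (rootWeight_nonneg hβ n fun w => τ (i :: w)) c).2
    have h2 := (lin_le_of_nonneg hβ1 (rootWeight_nonneg hβ n fun w => τ (i :: w)) c').1
    refine h1.trans ?_
    rwa [inv_mul_eq_div, le_div_iff₀ hβ, mul_comm]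

/-- The root weights of all trees of sufficiently large height have ratios at most `a ^ d`. -/
def EventuallyBalanced (q d : ℕ) (β a : ℝ) : Prop :=
  ∀ᶠ n in atTop, ∀ τ : List (Fin d) → Fin q, Balanced (a ^ d) (rootWeight β n τ)

theorem Balanced.mono {q : ℕ} {α α' : ℝ} (h : α ≤ α') {r : Fin q → ℝ} (hr : Balanced α r) :
    Balanced α' r :=
  ⟨hr.1, fun c c' => (hr.2 c c').trans (mul_le_mul_of_nonneg_right h (hr.1 c').le)⟩

theorem EventuallyBalanced.mono {q d : ℕ} {β a a' : ℝ} (ha : 0 ≤ a) (h : a ≤ a')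
    (H : EventuallyBalanced q d β a) : EventuallyBalanced q d β a' :=
  Filter.Eventually.mono H fun _ hn τ => (hn τ).mono (pow_le_pow_left₀ ha h d)

/-- Were the infimum of the eventually valid `a` larger than 1, some bound just above it would,
after two more levels, yield one strictly below it. -/
theorem eventuallyBalanced {q d : ℕ} {κ₀ β : ℝ} (hκ₁ : κ₀ < 1) (H : VertexPositive q d κ₀)
    (hβ : 1 - κ₀ ≤ β) (hβ1 : β < 1) {a : ℝ} (ha : 1 < a) :
    EventuallyBalanced (q + 2) d β a := by
  have hβ0 : 0 < β := by linarith
  set B : Set ℝ := {a | 1 ≤ a ∧ EventuallyBalanced (q + 2) d β a} with hB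
  have hBne : B.Nonempty := by
    refine ⟨β⁻¹, (one_le_inv₀ hβ0).2 hβ1.le, ?_⟩
    filter_upwards [Filter.eventually_ge_atTop 1] with n hn τ
    obtain ⟨m, rfl⟩ := Nat.exists_eq_add_of_le' hn
    exact balanced_rootWeight_succ hβ0 hβ1.le m τ
  have hBbdd : BddBelow B := ⟨1, fun _ h => h.1⟩
  have hinf : sInf B = 1 := by
    by_contra hne
    have h1 : 1 < sInf B := lt_of_le_of_ne (le_csInf hBne fun _ h => h.1) (Ne.symm hne)
    have hsmall : ∀ᶠ δ in 𝓝[>] (0 : ℝ), δ < sInf B - 1 :=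
      nhdsWithin_le_nhds (gt_mem_nhds (by linarith))
    obtain ⟨δ, hδ, hδ1, hδ0⟩ := ((eventually_contracts (by linarith) hκ₁ H h1).and
      (hsmall.and self_mem_nhdsWithin)).exists
    have hδ0 : 0 < δ := hδ0
    obtain ⟨b, hb, hbδ⟩ := exists_lt_of_csInf_lt hBne (lt_add_of_pos_right (sInf B) hδ0)
    have hE : EventuallyBalanced (q + 2) d β (sInf B + δ) :=
      hb.2.mono (by linarith [hb.1]) hbδ.le
    have hmem : sInf B - δ ∈ B := by
      refine ⟨by linarith, ?_⟩
      obtain ⟨N, hN⟩ := Filter.eventually_atTop.1 hE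
      -- Two extra levels, so that the subtrees at the grandchildren have height at least `N`.
      filter_upwards [Filter.eventually_ge_atTop (N + 2)] with n hn τ
      obtain ⟨m, rfl⟩ := Nat.exists_eq_add_of_le' (show 2 ≤ n by omega)
      refine ⟨rootWeight_succ_pos hβ0 hβ1.le (m + 1) τ, fun c c' => ?_⟩
      have hpow : (sInf B - δ) ^ d = ∏ _i : Fin d, (sInf B - δ) := by simp
      change rootWeight β (m + 1 + 1) τ c ≤ _ * rootWeight β (m + 1 + 1) τ c'
      rw [rootWeight_succ_eq_lin, rootWeight_succ_eq_lin, hpow, ← Finset.prod_mul_distrib]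
      refine Finset.prod_le_prod (fun i _ => ?_) fun i _ => ?_
      · exact (lin_pos (by linarith) (rootWeight_succ_pos hβ0 hβ1.le m _) c).le
      · have hfun : rootWeight β (m + 1) (fun w => τ (i :: w)) = fun c =>
            ∏ j, lin (1 - β) (rootWeight β m fun w => τ (i :: j :: w)) c :=
          funext fun c => rootWeight_succ_eq_lin β m _ c
        rw [hfun]
        exact hδ (1 - β) (by linarith) (by linarith) _ (fun j => hN m (by omega) _) c c'
    have := csInf_le hBbdd hmem
    linarith
  obtain ⟨b, hb, hba⟩ := exists_lt_of_csInf_lt hBne (hinf.trans_lt ha)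
  exact hb.2.mono (by linarith [hb.1]) hba.le

theorem abs_div_sum_sub_le {q : ℕ} {α : ℝ} (hα : 1 ≤ α) {r : Fin q → ℝ} (hr : Balanced α r)
    (c : Fin q) : |r c / ∑ i, r i - 1 / q| ≤ α - 1 := by
  have hq : (1 : ℝ) ≤ q := by exact_mod_cast Fin.pos c
  have hq0 : (0 : ℝ) < q := by linarith
  have hpos : 0 < ∑ i, r i := Finset.sum_pos (fun i _ => hr.1 i) ⟨c, Finset.mem_univ c⟩
  have h1 : q * r c ≤ α * ∑ i, r i := by
    have := Finset.sum_le_sum fun i (_ : i ∈ Finset.univ) => hr.2 c i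
    simpa [← Finset.mul_sum] using this
  have h2 : ∑ i, r i ≤ q * (α * r c) := by
    have := Finset.sum_le_sum fun i (_ : i ∈ Finset.univ) => hr.2 i c
    simpa using this
  have h3 : r c ≤ ∑ i, r i :=
    Finset.single_le_sum (fun i _ => (hr.1 i).le) (Finset.mem_univ c)
  have h4 : r c / ∑ i, r i - 1 / q = (q * r c - ∑ i, r i) / (q * ∑ i, r i) := by
    field_simp
  have h5 : (α - 1) * ∑ i, r i ≤ (α - 1) * (q * ∑ i, r i) :=
    mul_le_mul_of_nonneg_left (le_mul_of_one_le_left hpos.le hq) (by linarith)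
  have h6 : (α - 1) * (q * r c) ≤ (α - 1) * (q * ∑ i, r i) :=
    mul_le_mul_of_nonneg_left (mul_le_mul_of_nonneg_left h3 hq0.le) (by linarith)
  rw [h4, abs_div, abs_of_pos (mul_pos hq0 hpos), div_le_iff₀ (mul_pos hq0 hpos), abs_le]
  constructor <;> linarith

theorem hasUniqueness_of_vertexPositive {q d : ℕ} {κ₀ β : ℝ} (hκ₁ : κ₀ < 1)
    (H : VertexPositive q d κ₀) (hβ : 1 - κ₀ ≤ β) (hβ1 : β < 1) :
    HasUniqueness (q + 2) d β := by
  classical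
  intro c
  have hβ0 : 0 < β := by linarith
  refine Filter.Tendsto.limsup_eq ?_
  rw [Metric.tendsto_atTop]
  intro ε hε
  have hcont : Filter.Tendsto (fun a : ℝ => a ^ d - 1) (𝓝[>] 1) (𝓝 0) := by
    have : Continuous fun a : ℝ => a ^ d - 1 := by fun_prop
    simpa using (this.tendsto 1).mono_left nhdsWithin_le_nhds
  obtain ⟨a, haε, ha⟩ := ((hcont.eventually (gt_mem_nhds hε)).and self_mem_nhdsWithin).exists
  have ha : 1 < a := ha
  obtain ⟨N, hN⟩ := Filter.eventually_atTop.1 (eventuallyBalanced hκ₁ H hβ hβ1 ha)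
  refine ⟨N, fun n hn => ?_⟩
  have hα : 1 ≤ a ^ d := one_le_pow₀ ha.le
  have hle : (⨆ τ : leaves d n → Fin (q + 2), |rootProb β c τ - 1 / ((q + 2 : ℕ) : ℝ)|) ≤
      a ^ d - 1 := by
    refine Real.iSup_le (fun τ => ?_) (by linarith)
    -- The value `c` off the leaves is arbitrary.
    let τ' : List (Fin d) → Fin (q + 2) := fun w =>
      if h : w.length = n then τ ⟨⟨w, h.le⟩, h⟩ else c
    have hτ : ∀ v : leaves d n, τ v = τ' v.1.1 := by
      rintro ⟨v, hv⟩
      have hv' : v.1.length = n := hv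
      simp only [τ', dif_pos hv']
    rw [rootProb_eq hβ0 c τ τ' hτ]
    exact abs_div_sum_sub_le hα (hN n hn τ') c
  have hge : 0 ≤ ⨆ τ : leaves d n → Fin (q + 2), |rootProb β c τ - 1 / ((q + 2 : ℕ) : ℝ)| :=
    Real.iSup_nonneg fun τ => abs_nonneg _
  rw [Real.dist_eq, sub_zero, abs_of_nonneg hge]
  linarith

/-! ### The certificates -/

/-- With `x = a - 1` and `κ₀ = (b - 1) / b`, multiplying each of the `d` factors and `gap` itself by
`b` clears denominators; hence the factor `b ^ (d + 1)`. -/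
theorem vertexPositive_of_certificate {b q d : ℕ} {α : List ℕ} (hb : 1 ≤ b)
    (hα : ∀ x : ℝ, polyVal x α = (1 + x) ^ d) (h : certificate b (q + 2) d α = true) :
    VertexPositive q d ((b - 1) / b) := by
  intro a ha S hS
  have hb0 : (0 : ℝ) < b := by exact_mod_cast hb
  set F : Fin d → Fin (q + 2) → ℝ := fun j i =>
    b * (∑ k, if S j k then a ^ d else 1) - (b - 1) * (if S j i then a ^ d else 1) with hF
  have hA : polyVal (a - 1) α = a ^ d := by rw [hα]; ring
  have hone : Represents (a - 1) (List.replicate (q + 2) [1]) fun _ : Fin (q + 2) => (1 : ℝ) := by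
    rw [Represents, List.ofFn_const, List.map_replicate]
    simp [polyVal]
  have hpos := pos_of_searchPos (sub_pos.2 ha) hb d _ _ _ hone h (List.ofFn F) (by simp) (by
    intro w hw
    obtain ⟨j, rfl⟩ := List.mem_ofFn.1 hw
    refine ⟨_, List.mem_map.2 ⟨List.ofFn (S j), List.mem_filter.2
      ⟨mem_boolLists (by simp), ?_⟩, rfl⟩, represents_factors hA (S j)⟩
    have := hS j
    simp [List.getD_eq_getElem?_getD, this])
  have hprod : ∀ i, ((List.ofFn F).map (· i)).prod =
      (b : ℝ) ^ d * ∏ j, lin (((b : ℝ) - 1) / b) (vertex (a ^ d) (S j)) i := by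
    intro i
    rw [List.map_ofFn, List.prod_ofFn]
    have : ∀ j, F j i = b * lin (((b : ℝ) - 1) / b) (vertex (a ^ d) (S j)) i := by
      intro j
      simp only [hF, lin, vertex]
      field_simp
    simp only [Function.comp_apply, this, Finset.prod_mul_distrib, Finset.prod_const,
      Finset.card_univ, Fintype.card_fin]
  simp only [hprod, one_mul, ← Finset.mul_sum] at hpos
  refine (pos_iff_pos_of_mul_pos (a := (b : ℝ) ^ (d + 1)) ?_).1 (pow_pos hb0 _)
  have h1 : (Fin.succ 0 : Fin (q + 2)) = 1 := rfl
  refine lt_of_lt_of_eq hpos (Eq.symm ?_)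
  simp only [gap, Fin.sum_univ_succ, h1]
  field_simp
  ring

end Potts

end

theorem mainTheorem7 :
    (∀ β : ℝ, 1 / 4 ≤ β → β < 1 → Potts.HasUniqueness 3 3 β) ∧
    (∀ β : ℝ, 1 / 5 ≤ β → β < 1 → Potts.HasUniqueness 4 4 β) := by
  constructor
  · intro β hβ hβ1
    have H := Potts.vertexPositive_of_certificate (q := 1) (by norm_num)
      (fun x => by simp only [Potts.polyVal]; push_cast; ring) Potts.certificate_three
    exact Potts.hasUniqueness_of_vertexPositive (by norm_num) H (by norm_num; linarith) hβ1
  · intro β hβ hβ1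
    have H := Potts.vertexPositive_of_certificate (q := 2) (by norm_num)
      (fun x => by simp only [Potts.polyVal]; push_cast; ring) Potts.certificate_four
    exact Potts.hasUniqueness_of_vertexPositive (by norm_num) H (by norm_num; linarith) hβ1
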